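/- Conventions. A continuum in a metric space $X$ is a nonempty compact connected subset of $X$ (one-point sets are allowed), and an arc in $X$ is a subset homeomorphic to $[0,1]$. A triod is a continuum $K$ for which there is a continuum $L\subseteq K$ such that $K\setminus L$ has at least three connected components. For a metric space $X$ let $$E^A_X=\{(x,y)\in X\times X:\ x=y\text{ or some arc in }X\text{ contains both }x\text{ and }y\}.$$ For $\varepsilon>0$ let $E^{CC,\varepsilon}_X$ be the equivalence relation on $X$ consisting of all $(x,y)\in X\times X$ for which there are $k\in\mathbb N$ and continua $K_0,\dots,K_k\subseteq X$ of diameter less than $\varepsilon$ such that $x\in K_0$, $y\in K_k$ and $K_i\cap K_{i+1}\neq\emptyset$ for $0\le i<k$. Let $E^{CC}_X=\bigcap_{\varepsilon>0}E^{CC,\varepsilon}_X$. (1) Let $X$ be a metric space. Suppose that for every integer $n\ge 1$, no equivalence class of $E^{CC,1/n}_X$ contains a triod (as a subset). Then $E^{CC}_X=E^A_X$. (2) Let $X$ be a Polish space (with any compatible metric) that contains no triod. Then $E^{CC}_X=E^A_X$. -/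

import Mathlib

namespace ContinuumConnection

/-- A continuum in `X`: a nonempty compact connected subset (one-point sets are continua;
`IsConnected` includes nonemptiness). -/
def IsContinuum {X : Type*} [TopologicalSpace X] (K : Set X) : Prop :=
  IsCompact K ∧ IsConnected K

/-- An arc in `X`: a subset homeomorphic to `[0, 1]`. -/
def IsArc {X : Type*} [TopologicalSpace X] (A : Set X) : Prop :=
  Nonempty (unitInterval ≃ₜ A)

/-- A triod: a continuum `K` with a subcontinuum `L` such that `K \ L` has at least three
connected components. -/
def IsTriod {X : Type*} [TopologicalSpace X] (K : Set X) : Prop :=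
  IsContinuum K ∧ ∃ L : Set X, IsContinuum L ∧ L ⊆ K ∧
    3 ≤ ENat.card (ConnectedComponents ↥(K \ L))

/-- The arc-connection relation `E^A_X`. Every point is related to itself, also when it lies
on no nondegenerate arc. -/
def arcRel (X : Type*) [TopologicalSpace X] : Set (X × X) :=
  {p | p.1 = p.2 ∨ ∃ A : Set X, IsArc A ∧ p.1 ∈ A ∧ p.2 ∈ A}

/-- The relation `E^{CC,ε}_X`: being joined by a finite chain `K 0, …, K k` of continua of
diameter less than `ε`. -/
def chainRelAt (X : Type*) [MetricSpace X] (ε : ℝ) : Set (X × X) :=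
  {p | ∃ (k : ℕ) (K : ℕ → Set X),
    (∀ i ≤ k, IsContinuum (K i) ∧ Metric.diam (K i) < ε) ∧
    p.1 ∈ K 0 ∧ p.2 ∈ K k ∧ ∀ i < k, (K i ∩ K (i + 1)).Nonempty}

/-- The chain continuum-connection relation `E^{CC}_X`. -/
def chainRel (X : Type*) [MetricSpace X] : Set (X × X) :=
  {p | ∀ ε : ℝ, 0 < ε → p ∈ chainRelAt X ε}

/-- The class of `x` with respect to a relation `E`. -/
def relClass {X : Type*} (E : Set (X × X)) (x : X) : Set X :=
  {y | (x, y) ∈ E}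

end ContinuumConnection

open ContinuumConnection

namespace ContinuumConnection

open Set

/-! ### Components of compact sets, and a criterion for triods -/

section Components

variable {X : Type*} [TopologicalSpace X]

/-! An arc is cut into small subarcs by uniform continuity, so arc-connected points are
chain-connected. Conversely, let `x ≠ y` be chain-connected and let `G` be the class of `x` at scale
1; it contains no triod, and it contains every chain of mesh at most 1 starting at `x`. For each `n`
the union of a `1/(n+1)`-chain from `x` to `y` is a continuum, hence contains a continuum `D n`
irreducible between `x` and `y`.

The crux is that `G` contains at most two such irreducible continua
(`NoTriod.eq_or_eq_of_irreducible`). This rests on two facts about sets without triods, both proved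
by boundary bumping: two continua meet in at most two components, and of three continua with a
common point one lies in the union of the others.

Hence a single `D` lies in the unions of arbitrarily fine chains. It meets each link in at most two
components, so it is a finite union of small continua, and irreducibility thins these to a chain in
which only neighbours meet. Such chains at every scale order `D` linearly and yield a continuous
injection into `ℝ`; thus `D` is an arc. -/

theorem IsContinuum.union {K L : Set X} (hK : IsContinuum K) (hL : IsContinuum L)
    (h : (K ∩ L).Nonempty) : IsContinuum (K ∪ L) :=
  ⟨hK.1.union hL.1, IsConnected.union h hK.2 hL.2⟩

theorem isContinuum_connectedComponentIn {S : Set X} (hS : IsCompact S) {p : X} (hp : p ∈ S) :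
    IsContinuum (connectedComponentIn S p) := by
  refine ⟨?_, isConnected_connectedComponentIn_iff.2 hp⟩
  have : CompactSpace S := isCompact_iff_compactSpace.1 hS
  rw [connectedComponentIn_eq_image hp]
  exact isClosed_connectedComponent.isCompact.image continuous_subtype_val

variable [T2Space X]

/-- In a compact set, each neighbourhood of a component contains a clopen piece around it. -/
theorem exists_clopen_piece {S : Set X} (hS : IsCompact S) {p : X} (hp : p ∈ S) {O : Set X}
    (hO : IsOpen O) (h : connectedComponentIn S p ⊆ O) :
    ∃ C D : Set X, IsClosed C ∧ IsClosed D ∧ Disjoint C D ∧ C ∪ D = S ∧ p ∈ C ∧ C ⊆ O := by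
  have : CompactSpace S := isCompact_iff_compactSpace.1 hS
  have hOc : IsCompact (((↑) : S → X) ⁻¹' Oᶜ) :=
    (hO.isClosed_compl.preimage continuous_subtype_val).isCompact
  -- The component is the intersection of the clopen sets around `p`; by compactness finitely many
  -- of them already avoid `Oᶜ`.
  have H1 := hOc.inter_iInter_nonempty
      (fun s : { s : Set S // IsClopen s ∧ (⟨p, hp⟩ : S) ∈ s } => s) fun s => s.2.1.1
  rw [← connectedComponent_eq_iInter_isClopen, ← not_disjoint_iff_nonempty_inter, imp_not_comm,
    not_forall] at H1
  obtain ⟨si, H2⟩ := H1 (by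
    rw [Set.disjoint_left]
    intro z hz hz'
    apply hz
    apply h
    rw [connectedComponentIn_eq_image hp]
    exact ⟨z, hz', rfl⟩)
  have hcl : IsClopen (⋂ U ∈ si, Subtype.val U) := isClopen_biInter_finset fun s _ => s.2.1
  set C := (⋂ U ∈ si, Subtype.val U) with hC
  refine ⟨(↑) '' C, (↑) '' Cᶜ, ?_, ?_, ?_, ?_, ?_, ?_⟩
  · exact (hcl.1.isCompact.image continuous_subtype_val).isClosed
  · exact (hcl.compl.1.isCompact.image continuous_subtype_val).isClosed
  · exact (disjoint_image_iff Subtype.val_injective).2 disjoint_compl_right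
  · rw [← image_union, union_compl_self, image_univ, Subtype.range_coe]
  · exact ⟨⟨p, hp⟩, mem_iInter₂.2 fun s _ => s.2.2, rfl⟩
  · rintro _ ⟨z, hz, rfl⟩
    by_contra hzO
    exact H2 ⟨z, hzO, hz⟩

/-- Boundary bumping. -/
theorem connectedComponentIn_inter_closure_not_subset {K O : Set X} (hK : IsContinuum K)
    (hO : IsOpen O)
    {p : X} (hpK : p ∈ K) (hpO : p ∈ O) (hKO : ¬ K ⊆ O) :
    ¬ connectedComponentIn (K ∩ closure O) p ⊆ O := by
  intro h
  obtain ⟨C, D, hC, hD, hCD, hU, hpC, hCO⟩ :=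
    exists_clopen_piece (hK.1.inter_right isClosed_closure) ⟨hpK, subset_closure hpO⟩ hO h
  -- `C` lies in `O` and misses `D`, so `C` and `D ∪ Oᶜ` would disconnect `K`.
  have hKC : K ⊆ C ∪ (D ∪ Oᶜ) := by
    intro z hz
    by_cases hzO : z ∈ O
    · have : z ∈ C ∪ D := hU ▸ ⟨hz, subset_closure hzO⟩
      rcases this with h | h
      · exact Or.inl h
      · exact Or.inr (Or.inl h)
    · exact Or.inr (Or.inr hzO)
  obtain ⟨k, hk, hkO⟩ := not_subset.1 hKO
  obtain ⟨z, -, hzC, hz⟩ := isPreconnected_closed_iff.1 hK.2.2 C (D ∪ Oᶜ) hC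
    (hD.union hO.isClosed_compl) hKC ⟨p, hpK, hpC⟩ ⟨k, hk, Or.inr hkO⟩
  rcases hz with hz | hz
  · exact Set.disjoint_left.1 hCD hzC hz
  · exact hz (hCO hzC)

/-- Three points in different components of a compact set are separated by a partition of that set
into three closed pieces. -/
theorem exists_three_pieces {S : Set X} (hS : IsCompact S) {a b c : X} (ha : a ∈ S) (hb : b ∈ S)
    (hab : b ∉ connectedComponentIn S a) (hac : c ∉ connectedComponentIn S a)
    (hbc : c ∉ connectedComponentIn S b) :
    ∃ A B C : Set X, IsClosed A ∧ IsClosed B ∧ IsClosed C ∧ Disjoint A B ∧ Disjoint A C ∧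
      Disjoint B C ∧ A ∪ B ∪ C = S ∧ a ∈ A ∧ b ∈ B ∧ (c ∈ S → c ∈ C) := by
  obtain ⟨A, A', hA, hA', hAA, hAS, haA, hAO⟩ := exists_clopen_piece hS ha (O := {b, c}ᶜ)
    (Set.toFinite _).isClosed.isOpen_compl (by
      intro z hz hz'
      rcases hz' with rfl | rfl
      exacts [hab hz, hac hz])
  obtain ⟨B, B', hB, hB', hBB, hBS, hbB, hBO⟩ := exists_clopen_piece hS hb (O := {c}ᶜ)
    isOpen_compl_singleton (by
      intro z hz hz'
      rw [mem_singleton_iff] at hz'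
      exact hbc (hz' ▸ hz))
  have hbA : b ∉ A := fun h => hAO h (by simp)
  have hcA : c ∉ A := fun h => hAO h (by simp)
  have hcB : c ∉ B := fun h => hBO h (by simp)
  refine ⟨A, B ∩ A', B' ∩ A', hA, hB.inter hA', hB'.inter hA', hAA.mono_right inter_subset_right,
    hAA.mono_right inter_subset_right, hBB.mono inter_subset_left inter_subset_left, ?_, haA,
    ⟨hbB, ?_⟩, fun hc => ⟨?_, ?_⟩⟩
  · rw [union_assoc, ← union_inter_distrib_right, hBS, ← hAS]
    ext z; simp only [mem_union, mem_inter_iff]; tauto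
  · exact (hAS ▸ hb : b ∈ A ∪ A').resolve_left hbA
  · exact (hBS ▸ hc : c ∈ B ∪ B').resolve_left hcB
  · exact (hAS ▸ hc : c ∈ A ∪ A').resolve_left hcA

/-- Three continua attached to `L` that leave it and meet each other only inside it form a
triod. -/
theorem isTriod_of_three_legs {L : Set X} {Z : Fin 3 → Set X} (hL : IsContinuum L)
    (hZ : ∀ i, IsContinuum (Z i)) (hZL : ∀ i, (L ∩ Z i).Nonempty) (hleave : ∀ i, ¬ Z i ⊆ L)
    (hmeet : ∀ i j, i ≠ j → Z i ∩ Z j ⊆ L) : IsTriod (L ∪ Z 0 ∪ Z 1 ∪ Z 2) := by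
  have hK : IsContinuum (L ∪ Z 0 ∪ Z 1 ∪ Z 2) :=
    ((hL.union (hZ 0) (hZL 0)).union (hZ 1)
      ((hZL 1).mono (inter_subset_inter_left _ subset_union_left))).union (hZ 2)
      ((hZL 2).mono (inter_subset_inter_left _
        (subset_union_left.trans subset_union_left)))
  refine ⟨hK, L, hL, subset_union_left.trans (subset_union_left.trans subset_union_left), ?_⟩
  set K := L ∪ Z 0 ∪ Z 1 ∪ Z 2 with hKdef
  have hsub : ∀ i, Z i ⊆ K := by
    intro i z hz
    fin_cases i <;> simp only [hKdef, mem_union] <;> tauto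
  have hcov : ∀ z : ↥(K \ L), ∃ i, (z : X) ∈ Z i := by
    rintro ⟨z, hz, hzL⟩
    rcases hz with ((h | h) | h) | h
    exacts [absurd h hzL, ⟨0, h⟩, ⟨1, h⟩, ⟨2, h⟩]
  choose w hwZ hwL using fun i => not_subset.1 (hleave i)
  let v : Fin 3 → ↥(K \ L) := fun i => ⟨w i, hsub i (hwZ i), hwL i⟩
  have hclosed : ∀ i, IsClosed (((↑) : ↥(K \ L) → X) ⁻¹' Z i) := fun i =>
    (hZ i).1.isClosed.preimage continuous_subtype_val
  -- Off `L` the three closed legs are disjoint and exhaust `K \ L`, so each is clopen there and no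
  -- component meets two of them.
  have hclopen : ∀ i, IsClopen (((↑) : ↥(K \ L) → X) ⁻¹' Z i) := by
    intro i
    refine ⟨hclosed i, ?_⟩
    have : (((↑) : ↥(K \ L) → X) ⁻¹' Z i) =
        (⋃ j : {j // j ≠ i}, ((↑) : ↥(K \ L) → X) ⁻¹' Z j)ᶜ := by
      ext z
      simp only [mem_preimage, mem_compl_iff, mem_iUnion, not_exists]
      refine ⟨fun hz j hj => z.2.2 (hmeet _ _ j.2 ⟨hj, hz⟩), fun h => ?_⟩
      obtain ⟨j, hj⟩ := hcov z
      by_cases hji : j = i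
      · exact hji ▸ hj
      · exact absurd hj (h ⟨j, hji⟩)
    rw [this, isOpen_compl_iff]
    exact isClosed_iUnion_of_finite fun j => hclosed j
  have hinj : Function.Injective fun i => (v i : ConnectedComponents ↥(K \ L)) := by
    intro i j hij
    by_contra hne
    have h1 := ConnectedComponents.coe_eq_coe'.1 hij
    have h2 : v i ∈ (((↑) : ↥(K \ L) → X) ⁻¹' Z j) :=
      (hclopen j).connectedComponent_subset (hwZ j) h1
    exact hwL i (hmeet i j hne ⟨hwZ i, h2⟩)
  simpa using ENat.card_le_card_of_injective hinj

end Components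

/-- A set containing no triod. -/
def NoTriod {X : Type*} [TopologicalSpace X] (G : Set X) : Prop :=
  ¬ ∃ T : Set X, IsTriod T ∧ T ⊆ G

/-! ### Intersections of continua in a set without triods -/

section Atriodic

variable {X : Type*} [MetricSpace X] {G : Set X}

open Metric

/-- In the absence of triods, two meeting continua intersect in at most two components. -/
theorem NoTriod.inter_eq_union_components (hG : NoTriod G) {K L : Set X} (hK : IsContinuum K)
    (hL : IsContinuum L) (hKG : K ⊆ G) (hLG : L ⊆ G) {a b : X} (ha : a ∈ K ∩ L) (hb : b ∈ K ∩ L)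
    (hab : b ∉ connectedComponentIn (K ∩ L) a) :
    K ∩ L = connectedComponentIn (K ∩ L) a ∪ connectedComponentIn (K ∩ L) b := by
  refine Subset.antisymm (fun c hc => ?_)
    (union_subset (connectedComponentIn_subset _ _) (connectedComponentIn_subset _ _))
  by_contra hcab
  rw [mem_union, not_or] at hcab
  have hS : IsCompact (K ∩ L) := hK.1.inter_right hL.1.isClosed
  obtain ⟨A, B, C, hA, hB, hC, hAB, hAC, hBC, hU, haA, hbB, hcC⟩ :=
    exists_three_pieces hS ha hb hab hcab.1 hcab.2
  replace hcC := hcC hc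
  -- Given a third component, bumping inside `K` grows a leg from each of the three pieces, within
  -- disjoint neighbourhoods; attached to `L`, they form a triod.
  let F : Fin 3 → Set X := ![A, B, C]
  let f : Fin 3 → X := ![a, b, c]
  have hFS : ∀ i, F i ⊆ K ∩ L := by
    intro i z hz
    rw [← hU]
    fin_cases i <;> simp [F] at hz <;> simp [hz]
  have hFc : ∀ i, IsClosed (F i) := by
    intro i
    fin_cases i <;> simpa [F]
  have hSF : ∀ z ∈ K ∩ L, ∃ i, z ∈ F i := by
    intro z hz
    rw [← hU] at hz
    rcases hz with (h | h) | h
    exacts [⟨0, h⟩, ⟨1, h⟩, ⟨2, h⟩]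
  have hfF : ∀ i, f i ∈ F i := by
    intro i
    fin_cases i <;> simpa [F, f]
  have hdis : ∀ i j, i ≠ j → Disjoint (F i) (F j) := by
    intro i j hij
    fin_cases i <;> fin_cases j <;> simp [F] at hij ⊢
    exacts [hAB, hAC, hAB.symm, hBC, hAC.symm, hBC.symm]
  have hδ : ∃ δ > 0, ∀ i j, i ≠ j → Disjoint (cthickening δ (F i)) (cthickening δ (F j)) := by
    have : ∀ i j, ∃ δ > 0, i ≠ j → Disjoint (cthickening δ (F i)) (cthickening δ (F j)) := by
      intro i j
      by_cases hij : i = j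
      · exact ⟨1, one_pos, fun h => absurd hij h⟩
      · obtain ⟨δ, h0, h⟩ := (hdis i j hij).exists_cthickenings
          (hS.of_isClosed_subset (hFc i) (hFS i)) (hFc j)
        exact ⟨δ, h0, fun _ => h⟩
    choose d hd0 hd using this
    obtain ⟨p, hp⟩ := Finite.exists_min (fun p : Fin 3 × Fin 3 => d p.1 p.2)
    refine ⟨d p.1 p.2, hd0 _ _, fun i j hij => ?_⟩
    exact (hd i j hij).mono (cthickening_mono (hp (i, j)) _) (cthickening_mono (hp (i, j)) _)
  obtain ⟨δ, hδ0, hδ⟩ := hδ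
  let O : Fin 3 → Set X := fun i => thickening δ (F i)
  have hOcl : ∀ i, closure (O i) ⊆ cthickening δ (F i) := fun i =>
    closure_thickening_subset_cthickening _ _
  have hFO : ∀ i, F i ⊆ O i := fun i => self_subset_thickening hδ0 _
  let Z : Fin 3 → Set X := fun i => connectedComponentIn (K ∩ closure (O i)) (f i)
  have hfK : ∀ i, f i ∈ K ∩ closure (O i) := fun i =>
    ⟨(hFS i (hfF i)).1, subset_closure (hFO i (hfF i))⟩
  have hZsub : ∀ i, Z i ⊆ K ∩ closure (O i) := fun i => connectedComponentIn_subset _ _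
  have hZO : ∀ i, ¬ Z i ⊆ O i := by
    intro i
    refine connectedComponentIn_inter_closure_not_subset hK isOpen_thickening (hfK i).1
      (hFO i (hfF i)) ?_
    intro hKO
    obtain ⟨j, hj⟩ : ∃ j : Fin 3, i ≠ j := ⟨i + 1, by fin_cases i <;> decide⟩
    exact Set.disjoint_left.1 (hδ i j hj) (hOcl i (subset_closure (hKO (hfK j).1)))
      (self_subset_cthickening _ (hfF j))
  refine hG ⟨_, isTriod_of_three_legs (Z := Z) hL (fun i => ?_) (fun i => ?_) (fun i => ?_)
    (fun i j hij => ?_), ?_⟩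
  · exact isContinuum_connectedComponentIn (hK.1.inter_right isClosed_closure) (hfK i)
  · exact ⟨f i, (hFS i (hfF i)).2, mem_connectedComponentIn (hfK i)⟩
  -- A leg inside `L` would lie in `K ∩ L` near `F i` only, hence in `F i ⊆ O i`, against bumping.
  · intro hZL
    refine hZO i fun z hz => ?_
    obtain ⟨j, hj⟩ := hSF z ⟨(hZsub i hz).1, hZL hz⟩
    by_cases hij : i = j
    · exact hFO i (hij ▸ hj)
    · exact absurd (self_subset_cthickening _ hj)
        (Set.disjoint_left.1 (hδ i j hij) (hOcl i (hZsub i hz).2))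
  · rintro z ⟨hi, hj⟩
    exact absurd (hOcl j (hZsub j hj).2)
      (Set.disjoint_left.1 (hδ i j hij) (hOcl i (hZsub i hi).2))
  · have : ∀ i, Z i ⊆ G := fun i => ((hZsub i).trans inter_subset_left).trans hKG
    exact union_subset (union_subset (union_subset hLG (this 0)) (this 1)) (this 2)

/-- With at most two components, the rest of `K ∩ L` is empty or a single component, hence closed.
So the component at `p` has a neighbourhood free of other points of `K ∩ L`. -/
theorem NoTriod.exists_isolated_component (hG : NoTriod G) {K L : Set X} (hK : IsContinuum K)
    (hL : IsContinuum L) (hKG : K ⊆ G) (hLG : L ⊆ G) {p : X} (hp : p ∈ K ∩ L) :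
    ∃ R : Set X, IsClosed R ∧ Disjoint (connectedComponentIn (K ∩ L) p) R ∧
      K ∩ L = connectedComponentIn (K ∩ L) p ∪ R := by
  by_cases h : K ∩ L ⊆ connectedComponentIn (K ∩ L) p
  · exact ⟨∅, isClosed_empty, disjoint_empty _, by
      rw [union_empty]; exact h.antisymm (connectedComponentIn_subset _ _)⟩
  · obtain ⟨q, hq, hqp⟩ := not_subset.1 h
    refine ⟨connectedComponentIn (K ∩ L) q, (isContinuum_connectedComponentIn
      (hK.1.inter_right hL.1.isClosed) hq).1.isClosed, ?_,
      hG.inter_eq_union_components hK hL hKG hLG hp hq hqp⟩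
    rw [Set.disjoint_left]
    intro z h1 h2
    apply hqp
    rw [connectedComponentIn_eq h1, ← connectedComponentIn_eq h2]
    exact mem_connectedComponentIn hq

/-- Without triods, the component at `p` of the intersection of `K` with `L` can be enlarged inside
`K` so as to leave `L` without meeting `L` anywhere else. -/
theorem NoTriod.exists_leg (hG : NoTriod G) {K L : Set X} (hK : IsContinuum K)
    (hL : IsContinuum L) (hKG : K ⊆ G) (hLG : L ⊆ G) {p : X} (hp : p ∈ K ∩ L) (hKL : ¬ K ⊆ L) :
    ∃ P Z : Set X, IsContinuum P ∧ IsContinuum Z ∧ p ∈ P ∧ P ⊆ Z ∧ Z ⊆ K ∧ Z ∩ L = P ∧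
      ¬ Z ⊆ L := by
  obtain ⟨R, hR, hPR, hU⟩ := hG.exists_isolated_component hK hL hKG hLG hp
  have hP := isContinuum_connectedComponentIn (hK.1.inter_right hL.1.isClosed) hp
  have hpP := mem_connectedComponentIn hp
  have hPsub := connectedComponentIn_subset (K ∩ L) p
  set P := connectedComponentIn (K ∩ L) p
  obtain ⟨k, hkK, hkL⟩ := not_subset.1 hKL
  -- Keeping away from `R` prevents new contact with `L`; keeping away from `k` ensures that `K`
  -- leaves the neighbourhood, as bumping requires.
  have hd : Disjoint P (R ∪ {k}) := by
    rw [disjoint_union_right, disjoint_singleton_right]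
    exact ⟨hPR, fun h => hkL (hPsub h).2⟩
  obtain ⟨δ, hδ0, hδ⟩ := hd.exists_cthickenings hP.1 (hR.union isClosed_singleton)
  have hOcl : closure (thickening δ P) ⊆ cthickening δ P :=
    closure_thickening_subset_cthickening _ _
  have hPO : P ⊆ thickening δ P := self_subset_thickening hδ0 _
  have hout : ∀ z ∈ closure (thickening δ P), z ∉ R ∪ {k} := fun z hz hz' =>
    Set.disjoint_left.1 hδ (hOcl hz) (self_subset_cthickening _ hz')
  have hbump := connectedComponentIn_inter_closure_not_subset hK
    (isOpen_thickening (δ := δ) (E := P)) hp.1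
    (hPO hpP) (fun h => hout k (subset_closure (h hkK)) (Or.inr rfl))
  have hpS : p ∈ K ∩ closure (thickening δ P) := ⟨hp.1, subset_closure (hPO hpP)⟩
  have hPZ : P ⊆ connectedComponentIn (K ∩ closure (thickening δ P)) p :=
    hP.2.2.subset_connectedComponentIn hpP fun z hz => ⟨(hPsub hz).1, subset_closure (hPO hz)⟩
  have hZsub := connectedComponentIn_subset (K ∩ closure (thickening δ P)) p
  have hZL : connectedComponentIn (K ∩ closure (thickening δ P)) p ∩ L = P := by
    refine Subset.antisymm (fun z hz => ?_) fun z hz => ⟨hPZ hz, (hPsub hz).2⟩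
    have : z ∈ P ∪ R := hU ▸ ⟨(hZsub hz.1).1, hz.2⟩
    exact this.resolve_right fun h => hout z (hZsub hz.1).2 (Or.inl h)
  refine ⟨P, _, hP, isContinuum_connectedComponentIn (hK.1.inter_right isClosed_closure) hpS, hpP,
    hPZ, hZsub.trans inter_subset_left, hZL, fun h => hbump fun z hz => hPO ?_⟩
  rw [← hZL]
  exact ⟨hz, h hz⟩

/-- Of three continua with a common point in a set without triods, one lies in the union of the
others. -/
theorem NoTriod.subset_union_of_common_point (hG : NoTriod G) {A B C : Set X} (hA : IsContinuum A)
    (hB : IsContinuum B) (hC : IsContinuum C) (hAG : A ⊆ G) (hBG : B ⊆ G) (hCG : C ⊆ G) {p : X}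
    (hpA : p ∈ A) (hpB : p ∈ B) (hpC : p ∈ C) : A ⊆ B ∪ C ∨ B ⊆ A ∪ C ∨ C ⊆ A ∪ B := by
  by_contra! hcon
  obtain ⟨h1, h2, h3⟩ := hcon
  obtain ⟨P, Z, hP, hZ, hpP, hPZ, hZA, hZP, hZl⟩ := hG.exists_leg hA (hB.union hC ⟨p, hpB, hpC⟩)
    hAG (union_subset hBG hCG) ⟨hpA, Or.inl hpB⟩ h1
  obtain ⟨Q, Y, hQ, hY, hpQ, hQY, hYB, hYQ, hYl⟩ := hG.exists_leg hB (hA.union hC ⟨p, hpA, hpC⟩)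
    hBG (union_subset hAG hCG) ⟨hpB, Or.inl hpA⟩ h2
  obtain ⟨R, W, hR, hW, hpR, hRW, hWC, hWR, hWl⟩ := hG.exists_leg hC (hA.union hB ⟨p, hpA, hpB⟩)
    hCG (union_subset hAG hBG) ⟨hpC, Or.inl hpA⟩ h3
  -- The core of the triod. Each leg meets the other two continua only in its own part of the core,
  -- so legs meet only inside the core. The core lies in the union of any two of `A`, `B`, `C`, so a
  -- leg leaving that union leaves the core.
  have hL : IsContinuum (P ∪ Q ∪ R) :=
    (hP.union hQ ⟨p, hpP, hpQ⟩).union hR ⟨p, Or.inl hpP, hpR⟩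
  have hPBC : P ⊆ B ∪ C := hZP ▸ inter_subset_right
  have hQAC : Q ⊆ A ∪ C := hYQ ▸ inter_subset_right
  have hRAB : R ⊆ A ∪ B := hWR ▸ inter_subset_right
  have hZmem : ∀ z ∈ Z, z ∈ B ∪ C → z ∈ P ∪ Q ∪ R := fun z h h' =>
    Or.inl (Or.inl (hZP ▸ ⟨h, h'⟩))
  have hYmem : ∀ z ∈ Y, z ∈ A ∪ C → z ∈ P ∪ Q ∪ R := fun z h h' =>
    Or.inl (Or.inr (hYQ ▸ ⟨h, h'⟩))
  refine hG ⟨_, isTriod_of_three_legs (Z := ![Z, Y, W]) hL (fun i => ?_) (fun i => ?_)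
    (fun i => ?_) (fun i j hij => ?_), ?_⟩
  · fin_cases i
    exacts [hZ, hY, hW]
  · fin_cases i
    exacts [⟨p, Or.inr hpR, hPZ hpP⟩, ⟨p, Or.inr hpR, hQY hpQ⟩, ⟨p, Or.inr hpR, hRW hpR⟩]
  · fin_cases i
    · refine fun h => hZl fun z hz => ?_
      rcases h hz with (h | h) | h
      exacts [hPBC h, Or.inl (hYB (hQY h)), Or.inr (hWC (hRW h))]
    · refine fun h => hYl fun z hz => ?_
      rcases h hz with (h | h) | h
      exacts [Or.inl (hZA (hPZ h)), hQAC h, Or.inr (hWC (hRW h))]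
    · refine fun h => hWl fun z hz => ?_
      rcases h hz with (h | h) | h
      exacts [Or.inl (hZA (hPZ h)), Or.inr (hYB (hQY h)), hRAB h]
  · rintro z ⟨hi, hj⟩
    fin_cases i <;> fin_cases j <;> simp at hij hi hj
    · exact hZmem z hi (Or.inl (hYB hj))
    · exact hZmem z hi (Or.inr (hWC hj))
    · exact hZmem z hj (Or.inl (hYB hi))
    · exact hYmem z hi (Or.inr (hWC hj))
    · exact hZmem z hj (Or.inr (hWC hi))
    · exact hYmem z hj (Or.inr (hWC hi))
  · have hPA := hPZ.trans hZA
    have hQB := hQY.trans hYB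
    have hRC := hRW.trans hWC
    exact union_subset (union_subset (union_subset (union_subset (union_subset (hPA.trans hAG)
      (hQB.trans hBG)) (hRC.trans hCG)) (hZA.trans hAG)) (hYB.trans hBG)) (hWC.trans hCG)

end Atriodic

end ContinuumConnection

/-! ### Continua irreducible between two points -/

namespace ContinuumConnection

open Set

/-- A continuum irreducible between two points: minimal among the continua containing both. -/
def IsIrreducibleBetween {X : Type*} [TopologicalSpace X] (D : Set X) (x y : X) : Prop :=
  Minimal (fun N : Set X => IsContinuum N ∧ x ∈ N ∧ y ∈ N) D

section Irreducible

variable {X : Type*} [TopologicalSpace X]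

theorem IsIrreducibleBetween.isContinuum {D : Set X} {x y : X}
    (h : IsIrreducibleBetween D x y) : IsContinuum D := h.1.1

theorem IsIrreducibleBetween.left_mem {D : Set X} {x y : X}
    (h : IsIrreducibleBetween D x y) : x ∈ D := h.1.2.1

theorem IsIrreducibleBetween.right_mem {D : Set X} {x y : X}
    (h : IsIrreducibleBetween D x y) : y ∈ D := h.1.2.2

theorem IsIrreducibleBetween.eq_of_subset {D N : Set X} {x y : X}
    (h : IsIrreducibleBetween D x y) (hN : IsContinuum N) (hx : x ∈ N) (hy : y ∈ N)
    (hND : N ⊆ D) : N = D :=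
  hND.antisymm (h.2 ⟨hN, hx, hy⟩ hND)

end Irreducible

section Existence

variable {X : Type*} [MetricSpace X]

/-- If the intersection split into two closed parts, some member of the chain would lie in the union
of disjoint open neighbourhoods of them, hence in one of the two, and the other part would be empty.
-/
theorem isContinuum_sInter_of_isChain {c : Set (Set X)} (hc : ∀ K ∈ c, IsContinuum K)
    (hchain : IsChain (· ⊆ ·) c) (hne : c.Nonempty) {x : X} (hx : ∀ K ∈ c, x ∈ K) :
    IsContinuum (⋂₀ c) := by
  obtain ⟨K₀, hK₀⟩ := hne
  have hcl : IsClosed (⋂₀ c) := isClosed_sInter fun K hK => (hc K hK).1.isClosed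
  refine ⟨(hc K₀ hK₀).1.of_isClosed_subset hcl (sInter_subset_of_mem hK₀),
    ⟨x, fun K hK => hx K hK⟩, ?_⟩
  rw [isPreconnected_iff_subset_of_fully_disjoint_closed hcl]
  intro a b ha hb hab hd
  obtain ⟨u, v, hu, hv, hau, hbv, huv⟩ := normal_separation ha hb hd
  have : Nonempty c := ⟨⟨K₀, hK₀⟩⟩
  obtain ⟨⟨K, hK⟩, hKuv⟩ := exists_subset_nhds_of_isCompact (V := fun K : c => (K : Set X))
    (U := u ∪ v) (fun A B => (hchain.total A.2 B.2).elim
      (fun h => ⟨A, Subset.rfl, h⟩) fun h => ⟨B, h, Subset.rfl⟩)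
    (fun K => (hc K K.2).1) (fun z hz => (hu.union hv).mem_nhds (by
      rw [← sInter_eq_iInter] at hz
      exact union_subset_union hau hbv (hab hz)))
  have hsub : ⋂₀ c ⊆ K := sInter_subset_of_mem hK
  rcases (hc K hK).2.2.subset_or_subset hu hv huv hKuv with h | h
  · refine Or.inl fun z hz => (hab hz).resolve_right fun hzb => ?_
    exact Set.disjoint_left.1 huv (h (hsub hz)) (hbv hzb)
  · refine Or.inr fun z hz => (hab hz).resolve_left fun hza => ?_
    exact Set.disjoint_left.1 huv (hau hza) (h (hsub hz))

theorem IsContinuum.exists_irreducible {K : Set X} (hK : IsContinuum K) {x y : X} (hx : x ∈ K)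
    (hy : y ∈ K) : ∃ D ⊆ K, IsIrreducibleBetween D x y := by
  refine zorn_superset_nonempty {N : Set X | IsContinuum N ∧ x ∈ N ∧ y ∈ N}
    (fun c hcS hc hne => ?_) K ⟨hK, hx, hy⟩
  exact ⟨⋂₀ c, ⟨isContinuum_sInter_of_isChain (fun K hK => (hcS hK).1) hc hne
    (fun K hK => (hcS hK).2.1), fun K hK => (hcS hK).2.1, fun K hK => (hcS hK).2.2⟩,
    fun s hs => sInter_subset_of_mem hs⟩

end Existence

/-! ### At most two irreducible continua in a set without triods -/

section Uniqueness

variable {X : Type*} [MetricSpace X] {G : Set X} {x y : X}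

/-- If `x` and `y` shared a component of `D ∩ E`, irreducibility would make it equal to both `D` and
`E`. So they lie in two components, and there is no third. -/
theorem NoTriod.inter_irreducible (hG : NoTriod G) {D E : Set X}
    (hD : IsIrreducibleBetween D x y) (hE : IsIrreducibleBetween E x y) (hDG : D ⊆ G)
    (hEG : E ⊆ G) (hne : D ≠ E) :
    ∃ P Q : Set X, IsContinuum P ∧ IsContinuum Q ∧ x ∈ P ∧ y ∈ Q ∧ Disjoint P Q ∧
      D ∩ E = P ∪ Q := by
  have hx : x ∈ D ∩ E := ⟨hD.left_mem, hE.left_mem⟩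
  have hy : y ∈ D ∩ E := ⟨hD.right_mem, hE.right_mem⟩
  have hS : IsCompact (D ∩ E) := hD.isContinuum.1.inter_right hE.isContinuum.1.isClosed
  have hP := isContinuum_connectedComponentIn hS hx
  have hQ := isContinuum_connectedComponentIn hS hy
  have hxy : y ∉ connectedComponentIn (D ∩ E) x := by
    intro h
    have hsub := connectedComponentIn_subset (D ∩ E) x
    have h1 := hD.eq_of_subset hP (mem_connectedComponentIn hx) h (hsub.trans inter_subset_left)
    have h2 := hE.eq_of_subset hP (mem_connectedComponentIn hx) h (hsub.trans inter_subset_right)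
    exact hne (h1.symm.trans h2)
  refine ⟨_, _, hP, hQ, mem_connectedComponentIn hx, mem_connectedComponentIn hy, ?_,
    hG.inter_eq_union_components hD.isContinuum hE.isContinuum hDG hEG hx hy hxy⟩
  rw [Set.disjoint_left]
  intro z h1 h2
  apply hxy
  rw [connectedComponentIn_eq h1, ← connectedComponentIn_eq h2]
  exact mem_connectedComponentIn hy

/-- Crossing forces `D = P ∪ Q'`. The crossing point lies in `E ∩ F`, in the component of `x` or of
`y`, so `F` or `E` also splits there and shares a piece with `D`. Among the three pieces through
that point one lies in the union of the others: either `D` equals `E` or `F`, or an endpoint lies in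
the wrong piece. -/
theorem NoTriod.false_of_crossing (hG : NoTriod G) {D E F P Q P' Q' : Set X}
    (hD : IsIrreducibleBetween D x y) (hE : IsIrreducibleBetween E x y)
    (hF : IsIrreducibleBetween F x y) (hDG : D ⊆ G) (hEG : E ⊆ G) (hFG : F ⊆ G)
    (hDE : D ≠ E) (hDF : D ≠ F) (hEF : E ≠ F)
    (hP : IsContinuum P) (hxP : x ∈ P) (hyQ : y ∈ Q) (hPQ : Disjoint P Q) (hDEe : D ∩ E = P ∪ Q)
    (hQ' : IsContinuum Q') (hxP' : x ∈ P') (hyQ' : y ∈ Q') (hPQ' : Disjoint P' Q')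
    (hDFe : D ∩ F = P' ∪ Q') (hmeet : (P ∩ Q').Nonempty) : False := by
  obtain ⟨p, hpP, hpQ'⟩ := hmeet
  have hPDE : P ⊆ D ∩ E := hDEe ▸ subset_union_left
  have hQDF : Q' ⊆ D ∩ F := hDFe ▸ subset_union_right
  have hDeq : P ∪ Q' = D := hD.eq_of_subset (hP.union hQ' ⟨p, hpP, hpQ'⟩) (Or.inl hxP)
    (Or.inr hyQ') (union_subset (hPDE.trans inter_subset_left) (hQDF.trans inter_subset_left))
  obtain ⟨A, B, hA, hB, hxA, hyB, hAB, hEFe⟩ := hG.inter_irreducible hE hF hEG hFG hEF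
  have hAEF : A ⊆ E ∩ F := hEFe ▸ subset_union_left
  have hBEF : B ⊆ E ∩ F := hEFe ▸ subset_union_right
  have hyP : y ∉ P := fun h => Set.disjoint_left.1 hPQ h hyQ
  have hxQ' : x ∉ Q' := fun h => Set.disjoint_left.1 hPQ' hxP' h
  have hPG := (hPDE.trans inter_subset_left).trans hDG
  have hQG := (hQDF.trans inter_subset_left).trans hDG
  have hp : p ∈ A ∪ B := hEFe ▸ ⟨(hPDE hpP).2, (hQDF hpQ').2⟩
  rcases hp with hp | hp
  · have hFeq : A ∪ Q' = F := hF.eq_of_subset (hA.union hQ' ⟨p, hp, hpQ'⟩) (Or.inl hxA)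
      (Or.inr hyQ') (union_subset (hAEF.trans inter_subset_right) (hQDF.trans inter_subset_right))
    have hyA : y ∉ A := fun h => Set.disjoint_left.1 hAB h hyB
    rcases hG.subset_union_of_common_point hA hP hQ' ((hAEF.trans inter_subset_left).trans hEG)
      hPG hQG hp hpP hpQ' with h | h | h
    · refine hDF (hD.eq_of_subset hF.isContinuum hF.left_mem hF.right_mem ?_).symm
      rw [← hFeq, ← hDeq]
      exact union_subset h subset_union_right
    · refine hDF (hF.eq_of_subset hD.isContinuum hD.left_mem hD.right_mem ?_)
      rw [← hFeq, ← hDeq]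
      exact union_subset h subset_union_right
    · exact (h hyQ').elim hyA hyP
  · have hEeq : P ∪ B = E := hE.eq_of_subset (hP.union hB ⟨p, hpP, hp⟩) (Or.inl hxP)
      (Or.inr hyB) (union_subset (hPDE.trans inter_subset_right) (hBEF.trans inter_subset_left))
    have hxB : x ∉ B := fun h => Set.disjoint_left.1 hAB hxA h
    rcases hG.subset_union_of_common_point hB hP hQ' ((hBEF.trans inter_subset_left).trans hEG)
      hPG hQG hp hpP hpQ' with h | h | h
    · refine hDE (hD.eq_of_subset hE.isContinuum hE.left_mem hE.right_mem ?_).symm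
      rw [← hEeq, ← hDeq]
      exact union_subset subset_union_left h
    · exact (h hxP).elim hxB hxQ'
    · refine hDE (hE.eq_of_subset hD.isContinuum hD.left_mem hD.right_mem ?_)
      rw [← hEeq, ← hDeq, union_comm P B]
      exact union_subset subset_union_right h

theorem NoTriod.not_subset_union_of_irreducible (hG : NoTriod G) {D E F : Set X}
    (hD : IsIrreducibleBetween D x y) (hE : IsIrreducibleBetween E x y)
    (hF : IsIrreducibleBetween F x y) (hDG : D ⊆ G) (hEG : E ⊆ G) (hFG : F ⊆ G)
    (hDE : D ≠ E) (hDF : D ≠ F) (hEF : E ≠ F) : ¬ D ⊆ E ∪ F := by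
  intro hsub
  obtain ⟨P, Q, hP, hQ, hxP, hyQ, hPQ, hDEe⟩ := hG.inter_irreducible hD hE hDG hEG hDE
  obtain ⟨P', Q', hP', hQ', hxP', hyQ', hPQ', hDFe⟩ := hG.inter_irreducible hD hF hDG hFG hDF
  -- The `x`-pieces and the `y`-pieces cover the connected set `D`, so some `x`-piece meets a
  -- `y`-piece, necessarily from the other intersection.
  have hcov : D ⊆ (P ∪ P') ∪ (Q ∪ Q') := by
    intro z hz
    rcases hsub hz with h | h
    · have : z ∈ P ∪ Q := hDEe ▸ ⟨hz, h⟩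
      exact this.imp Or.inl Or.inl
    · have : z ∈ P' ∪ Q' := hDFe ▸ ⟨hz, h⟩
      exact this.imp Or.inr Or.inr
  obtain ⟨z, -, hz, hzQ⟩ := isPreconnected_closed_iff.1 hD.isContinuum.2.2 _ _
    (hP.1.isClosed.union hP'.1.isClosed) (hQ.1.isClosed.union hQ'.1.isClosed) hcov
    ⟨x, hD.left_mem, Or.inl hxP⟩ ⟨y, hD.right_mem, Or.inl hyQ⟩
  rcases hz with hz | hz <;> rcases hzQ with hzQ | hzQ
  · exact Set.disjoint_left.1 hPQ hz hzQ
  · exact hG.false_of_crossing hD hE hF hDG hEG hFG hDE hDF hEF hP hxP hyQ hPQ hDEe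
      hQ' hxP' hyQ' hPQ' hDFe ⟨z, hz, hzQ⟩
  · exact hG.false_of_crossing hD hF hE hDG hFG hEG hDF hDE hEF.symm hP' hxP' hyQ' hPQ' hDFe
      hQ hxP hyQ hPQ hDEe ⟨z, hz, hzQ⟩
  · exact Set.disjoint_left.1 hPQ' hz hzQ

/-- In a set without triods, there are at most two continua irreducible between given points. -/
theorem NoTriod.eq_or_eq_of_irreducible (hG : NoTriod G) {D E F : Set X}
    (hD : IsIrreducibleBetween D x y) (hE : IsIrreducibleBetween E x y)
    (hF : IsIrreducibleBetween F x y) (hDG : D ⊆ G) (hEG : E ⊆ G) (hFG : F ⊆ G)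
    (hDE : D ≠ E) : F = D ∨ F = E := by
  by_contra! h
  obtain ⟨hFD, hFE⟩ := h
  rcases hG.subset_union_of_common_point hD.isContinuum hE.isContinuum hF.isContinuum hDG hEG hFG
    hD.left_mem hE.left_mem hF.left_mem with h | h | h
  · exact hG.not_subset_union_of_irreducible hD hE hF hDG hEG hFG hDE hFD.symm hFE.symm h
  · exact hG.not_subset_union_of_irreducible hE hD hF hEG hDG hFG hDE.symm hFE.symm hFD.symm h
  · exact hG.not_subset_union_of_irreducible hF hD hE hFG hDG hEG hFD hFE hDE h

end Uniqueness

end ContinuumConnection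

/-! ### Chains of small continua -/

namespace ContinuumConnection

open Set Metric

section Chains

variable {X : Type*} [MetricSpace X]

theorem isContinuum_biUnion_chain {K : ℕ → Set X} {a b : ℕ} (hab : a ≤ b)
    (hK : ∀ i ∈ Icc a b, IsContinuum (K i))
    (hm : ∀ i, a ≤ i → i < b → (K i ∩ K (i + 1)).Nonempty) :
    IsContinuum (⋃ i ∈ Icc a b, K i) := by
  refine ⟨(finite_Icc a b).isCompact_biUnion fun i hi => (hK i hi).1, ?_⟩
  refine IsConnected.biUnion_of_chain ⟨a, left_mem_Icc.2 hab⟩ ordConnected_Icc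
    (fun i hi => (hK i hi).2) fun i hi hsucc => ?_
  rw [Order.succ_eq_add_one] at hsucc ⊢
  exact hm i hi.1 hsucc.2

/-- `K 0, …, K k` is a chain of continua of diameter less than `ε`, contained in `I` and starting
at `x`. -/
structure IsSmallChain (I : Set X) (x : X) (ε : ℝ) (K : ℕ → Set X) (k : ℕ) : Prop where
  isContinuum : ∀ i ≤ k, IsContinuum (K i)
  diam_lt : ∀ i ≤ k, diam (K i) < ε
  subset : ∀ i ≤ k, K i ⊆ I
  mem : x ∈ K 0
  meets : ∀ i < k, (K i ∩ K (i + 1)).Nonempty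

variable {I : Set X} {x y : X} {ε : ℝ} {K : ℕ → Set X} {k : ℕ}

theorem IsSmallChain.snoc (h : IsSmallChain I x ε K k) {F : Set X} (hF : IsContinuum F)
    (hFd : diam F < ε) (hFI : F ⊆ I) (hm : (K k ∩ F).Nonempty) :
    IsSmallChain I x ε (fun i => if i ≤ k then K i else F) (k + 1) where
  isContinuum i _ := by
    split_ifs with hi
    exacts [h.isContinuum i hi, hF]
  diam_lt i _ := by
    split_ifs with hi
    exacts [h.diam_lt i hi, hFd]
  subset i _ := by
    split_ifs with hi
    exacts [h.subset i hi, hFI]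
  mem := by simpa using h.mem
  meets i hi := by
    rcases Nat.lt_or_ge i k with hik | hik
    · rw [if_pos hik.le, if_pos (by omega)]
      exact h.meets i hik
    · obtain rfl : i = k := by omega
      rw [if_pos le_rfl, if_neg (by omega)]
      exact hm

/-- If two members of a chain that are not neighbours meet, the members between them can be
skipped. -/
theorem IsSmallChain.skip (h : IsSmallChain I x ε K k) {i j : ℕ} (hij : i + 2 ≤ j) (hjk : j ≤ k)
    (hm : (K i ∩ K j).Nonempty) :
    IsSmallChain I x ε (fun m => if m ≤ i then K m else K (m + (j - i - 1)))
      (k - (j - i - 1)) where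
  isContinuum m hmk := by
    split_ifs with hmi
    exacts [h.isContinuum _ (by omega), h.isContinuum _ (by omega)]
  diam_lt m hmk := by
    split_ifs with hmi
    exacts [h.diam_lt _ (by omega), h.diam_lt _ (by omega)]
  subset m hmk := by
    split_ifs with hmi
    exacts [h.subset _ (by omega), h.subset _ (by omega)]
  mem := by simpa using h.mem
  meets m hmk := by
    rcases lt_trichotomy m i with hmi | rfl | hmi
    · rw [if_pos hmi.le, if_pos (by omega)]
      exact h.meets m (by omega)
    · rw [if_pos le_rfl, if_neg (by omega), show m + 1 + (j - m - 1) = j by omega]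
      exact hm
    · rw [if_neg (by omega), if_neg (by omega),
        show m + 1 + (j - i - 1) = m + (j - i - 1) + 1 by omega]
      exact h.meets _ (by omega)

/-- A connected set that is a finite union of small continua is chained by small continua. -/
theorem exists_isSmallChain_of_finite_cover (hI : IsPreconnected I) (hx : x ∈ I) (hy : y ∈ I)
    {𝓕 : Set (Set X)} (hfin : 𝓕.Finite) (hF : ∀ F ∈ 𝓕, IsContinuum F)
    (hFd : ∀ F ∈ 𝓕, diam F < ε) (hFI : ∀ F ∈ 𝓕, F ⊆ I) (hcov : I ⊆ ⋃₀ 𝓕) :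
    ∃ K k, IsSmallChain I x ε K k ∧ y ∈ K k := by
  -- The members reachable by a chain from `x`; by connectedness their union meets that of the
  -- others if `y` is not reached.
  let 𝓡 : Set (Set X) := {F ∈ 𝓕 | ∃ K k, IsSmallChain I x ε K k ∧ K k = F}
  obtain ⟨F₀, hF₀, hxF₀⟩ := hcov hx
  have hF₀R : F₀ ∈ 𝓡 := ⟨hF₀, fun _ => F₀, 0,
    ⟨fun _ _ => hF _ hF₀, fun _ _ => hFd _ hF₀, fun _ _ => hFI _ hF₀, hxF₀, by simp⟩, rfl⟩
  by_contra hcon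
  obtain ⟨F₁, hF₁, hyF₁⟩ := hcov hy
  have hF₁R : F₁ ∉ 𝓡 := by
    rintro ⟨-, K, k, hK, rfl⟩
    exact hcon ⟨K, k, hK, hyF₁⟩
  have hclosed : ∀ 𝓢 ⊆ 𝓕, IsClosed (⋃₀ 𝓢) := fun 𝓢 h𝓢 => by
    rw [sUnion_eq_biUnion]
    exact (hfin.subset h𝓢).isClosed_biUnion fun F h => (hF F (h𝓢 h)).1.isClosed
  obtain ⟨z, -, ⟨F, hFR, hzF⟩, F', ⟨hF', hF'R⟩, hzF'⟩ := isPreconnected_closed_iff.1 hI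
    (⋃₀ 𝓡) (⋃₀ (𝓕 \ 𝓡))
    (hclosed 𝓡 fun F h => h.1) (hclosed (𝓕 \ 𝓡) fun F h => h.1)
    (by
      intro z hz
      obtain ⟨F, hF, hzF⟩ := hcov hz
      by_cases h : F ∈ 𝓡
      · exact Or.inl ⟨F, h, hzF⟩
      · exact Or.inr ⟨F, ⟨hF, h⟩, hzF⟩)
    ⟨x, hx, F₀, hF₀R, hxF₀⟩ ⟨y, hy, F₁, ⟨hF₁, hF₁R⟩, hyF₁⟩
  obtain ⟨-, K, k, hK, rfl⟩ := hFR
  exact hF'R ⟨hF', _, _, hK.snoc (hF _ hF') (hFd _ hF') (hFI _ hF') ⟨z, hzF, hzF'⟩, by simp⟩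

/-- A chain of small continua from `x` to `y` filling `I`, in which only neighbours meet. -/
structure IsTautChain (I : Set X) (x y : X) (ε : ℝ) (K : ℕ → Set X) (k : ℕ) : Prop
    extends IsSmallChain I x ε K k where
  right_mem : y ∈ K k
  disjoint : ∀ i j, i + 2 ≤ j → j ≤ k → Disjoint (K i) (K j)
  cover : ∀ z ∈ I, ∃ i ≤ k, z ∈ K i

/-- A chain with the fewest links works: if two non-neighbours met, it could be shortened, and its
union fills `I` by irreducibility. -/
theorem IsIrreducibleBetween.exists_isTautChain (hI : IsIrreducibleBetween I x y)
    {𝓕 : Set (Set X)} (hfin : 𝓕.Finite) (hF : ∀ F ∈ 𝓕, IsContinuum F)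
    (hFd : ∀ F ∈ 𝓕, diam F < ε) (hFI : ∀ F ∈ 𝓕, F ⊆ I) (hcov : I ⊆ ⋃₀ 𝓕) :
    ∃ K k, IsTautChain I x y ε K k := by
  classical
  have hex : ∃ k K, IsSmallChain I x ε K k ∧ y ∈ K k := by
    obtain ⟨K, k, h⟩ := exists_isSmallChain_of_finite_cover hI.isContinuum.2.2 hI.left_mem
      hI.right_mem hfin hF hFd hFI hcov
    exact ⟨k, K, h⟩
  obtain ⟨K, hK, hy⟩ := Nat.find_spec hex
  have hmin : ∀ m < Nat.find hex, ¬ ∃ K, IsSmallChain I x ε K m ∧ y ∈ K m :=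
    fun m hm => Nat.find_min hex hm
  set k := Nat.find hex
  refine ⟨K, k, hK, hy, fun i j hij hjk => ?_, fun z hz => ?_⟩
  · by_contra hd
    refine hmin (k - (j - i - 1)) (by omega) ⟨_, hK.skip hij hjk
      (Set.not_disjoint_iff_nonempty_inter.1 hd), ?_⟩
    rw [if_neg (by omega), Nat.sub_add_cancel (by omega)]
    exact hy
  · have hU : IsContinuum (⋃ i ∈ Icc 0 k, K i) :=
      isContinuum_biUnion_chain (Nat.zero_le _) (fun i hi => hK.isContinuum i hi.2)
        fun i _ hi => hK.meets i hi
    have := hI.eq_of_subset hU (mem_biUnion (left_mem_Icc.2 (Nat.zero_le _)) hK.mem)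
      (mem_biUnion (right_mem_Icc.2 (Nat.zero_le _)) hy)
      (iUnion₂_subset fun i hi => hK.subset i hi.2)
    rw [← this] at hz
    simp only [mem_iUnion, mem_Icc] at hz
    obtain ⟨i, hi, hz⟩ := hz
    exact ⟨i, hi.2, hz⟩

theorem IsSmallChain.dist_lt (h : IsSmallChain I x ε K k) {i : ℕ} (hi : i ≤ k) {a b : X}
    (ha : a ∈ K i) (hb : b ∈ K i) : dist a b < ε :=
  (dist_le_diam_of_mem (h.isContinuum i hi).1.isBounded ha hb).trans_lt (h.diam_lt i hi)

theorem IsSmallChain.dist_lt_of_succ (h : IsSmallChain I x ε K k) {i : ℕ} (hi : i < k) {a b : X}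
    (ha : a ∈ K i) (hb : b ∈ K (i + 1)) : dist a b < 2 * ε := by
  obtain ⟨c, hc, hc'⟩ := h.meets i hi
  linarith [dist_triangle a c b, h.dist_lt hi.le ha hc, h.dist_lt (Nat.succ_le_of_lt hi) hc' hb]

theorem IsSmallChain.dist_lt_of_le (h : IsSmallChain I x ε K k) {i j : ℕ} (hij : i ≤ j)
    (hji : j ≤ i + 1) (hj : j ≤ k) {a b : X} (ha : a ∈ K i) (hb : b ∈ K j) :
    dist a b < 2 * ε := by
  rcases hij.eq_or_lt with rfl | hlt
  · linarith [h.dist_lt hj ha hb, @dist_nonneg _ _ a b]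
  · obtain rfl : j = i + 1 := by omega
    exact h.dist_lt_of_succ hj ha hb

end Chains

/-! ### From taut chains to an arc -/

section Arc

variable {X : Type*} [MetricSpace X] {I : Set X} {x y : X} {ε : ℝ} {K : ℕ → Set X} {k : ℕ}

/-- The points of `I` that cannot be avoided in passing from `x` to `z` by a subcontinuum. -/
def initialPart (I : Set X) (x z : X) : Set X :=
  ⋂₀ {N : Set X | IsContinuum N ∧ N ⊆ I ∧ x ∈ N ∧ z ∈ N}

theorem isClosed_initialPart (I : Set X) (x z : X) : IsClosed (initialPart I x z) :=
  isClosed_sInter fun _ hN => hN.1.1.isClosed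

theorem self_mem_initialPart (I : Set X) (x z : X) : z ∈ initialPart I x z :=
  fun _ hN => hN.2.2.2

theorem IsSmallChain.initialPart_subset (h : IsSmallChain I x ε K k) {i : ℕ} (hi : i ≤ k) {z : X}
    (hz : z ∈ K i) {w : X} (hw : w ∈ initialPart I x z) : ∃ m ≤ i, w ∈ K m := by
  have hU : IsContinuum (⋃ m ∈ Icc 0 i, K m) :=
    isContinuum_biUnion_chain (Nat.zero_le _) (fun m hm => h.isContinuum m (hm.2.trans hi))
      fun m _ hm => h.meets m (hm.trans_le hi)
  have := hw _ ⟨hU, iUnion₂_subset fun m hm => h.subset m (hm.2.trans hi),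
    mem_biUnion (left_mem_Icc.2 (Nat.zero_le _)) h.mem,
    mem_biUnion (right_mem_Icc.2 (Nat.zero_le _)) hz⟩
  simp only [mem_iUnion, mem_Icc] at this
  obtain ⟨m, hm, hw⟩ := this
  exact ⟨m, hm.2, hw⟩

/-- A continuum in `I` joining `x` to `z`, together with the links from `i` on, joins `x` to `y` and
so is all of `I`. Those later links miss `K m`. -/
theorem IsTautChain.subset_initialPart (hI : IsIrreducibleBetween I x y)
    (h : IsTautChain I x y ε K k) {m i : ℕ} (hmi : m + 2 ≤ i) (hi : i ≤ k) {z : X}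
    (hz : z ∈ K i) : K m ⊆ initialPart I x z := by
  rintro w hw N ⟨hN, hNI, hxN, hzN⟩
  have hU : IsContinuum (⋃ j ∈ Icc i k, K j) :=
    isContinuum_biUnion_chain hi (fun j hj => h.isContinuum j hj.2) fun j _ hj => h.meets j hj
  have heq := hI.eq_of_subset (hN.union hU ⟨z, hzN, mem_biUnion (left_mem_Icc.2 hi) hz⟩)
    (Or.inl hxN) (Or.inr (mem_biUnion (right_mem_Icc.2 hi) h.right_mem))
    (union_subset hNI (iUnion₂_subset fun j hj => h.subset j hj.2))
  have hwI : w ∈ I := h.subset m (by omega) hw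
  rw [← heq] at hwI
  refine hwI.resolve_right fun hw' => ?_
  simp only [mem_iUnion, mem_Icc] at hw'
  obtain ⟨j, hj, hwj⟩ := hw'
  exact Set.disjoint_left.1 (h.disjoint m j (by omega) hj.2) hw hwj

theorem IsTautChain.initialPart_lt (hI : IsIrreducibleBetween I x y)
    (h : IsTautChain I x y ε K k) {i j : ℕ} (hij : i + 2 ≤ j) (hj : j ≤ k) {z z' : X}
    (hz : z ∈ K i) (hz' : z' ∈ K j) :
    initialPart I x z ⊆ initialPart I x z' ∧ z' ∉ initialPart I x z := by
  refine ⟨fun w hw => ?_, fun hw => ?_⟩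
  · obtain ⟨m, hm, hwm⟩ := h.initialPart_subset (by omega) hz hw
    exact h.subset_initialPart hI (by omega) hj hz' hwm
  · obtain ⟨m, hm, hwm⟩ := h.initialPart_subset (by omega) hz hw
    exact Set.disjoint_left.1 (h.disjoint m j (by omega) hj) hwm hz'

theorem IsIrreducibleBetween.initialPart_total (hI : IsIrreducibleBetween I x y)
    (hch : ∀ ε > 0, ∃ K k, IsTautChain I x y ε K k) {z z' : X} (hz : z ∈ I) (hz' : z' ∈ I)
    (hne : z ≠ z') :
    (initialPart I x z ⊆ initialPart I x z' ∧ z' ∉ initialPart I x z) ∨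
      (initialPart I x z' ⊆ initialPart I x z ∧ z ∉ initialPart I x z') := by
  have hd := dist_pos.2 hne
  -- At this mesh, points in equal or adjacent links are closer than `dist z z'`, so `z` and `z'`
  -- lie in links at least two apart.
  obtain ⟨K, k, h⟩ := hch (dist z z' / 2) (half_pos hd)
  obtain ⟨i, hi, hzi⟩ := h.cover z hz
  obtain ⟨j, hj, hzj⟩ := h.cover z' hz'
  by_cases hij : i + 2 ≤ j
  · exact Or.inl (h.initialPart_lt hI hij hj hzi hzj)
  by_cases hji : j + 2 ≤ i
  · exact Or.inr (h.initialPart_lt hI hji hi hzj hzi)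
  exfalso
  rcases le_total i j with hle | hle
  · linarith [h.dist_lt_of_le hle (by omega) hj hzi hzj]
  · linarith [h.dist_lt_of_le hle (by omega) hi hzj hzi, dist_comm z z']

/-- Initial parts of points in one link agree up to the last two links, and points there are within
`2 * ε` of `z`. -/
theorem IsTautChain.infDist_le (hI : IsIrreducibleBetween I x y) (h : IsTautChain I x y ε K k)
    {i : ℕ} (hi : i ≤ k) {z z' : X} (hz : z ∈ K i) (hz' : z' ∈ K i) (q : X) :
    infDist q (initialPart I x z) ≤ infDist q (initialPart I x z') + 2 * ε := by
  rw [← sub_le_iff_le_add, le_infDist ⟨z', self_mem_initialPart I x z'⟩]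
  intro w hw
  have hε : 0 < ε := diam_nonneg.trans_lt (h.diam_lt i hi)
  obtain ⟨m, hm, hwm⟩ := h.initialPart_subset hi hz' hw
  by_cases hmi : m + 2 ≤ i
  · linarith [infDist_le_dist_of_mem (x := q) (h.subset_initialPart hI hmi hi hz hwm)]
  · linarith [infDist_le_dist_of_mem (x := q) (self_mem_initialPart I x z), dist_triangle q w z,
      h.dist_lt_of_le hm (by omega) hi hwm hz]

theorem IsIrreducibleBetween.continuous_infDist_initialPart (hI : IsIrreducibleBetween I x y)
    (hch : ∀ ε > 0, ∃ K k, IsTautChain I x y ε K k) (q : X) :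
    Continuous fun z : I => infDist q (initialPart I x z) := by
  rw [continuous_iff']
  intro z ε hε
  obtain ⟨K, k, h⟩ := hch (ε / 3) (by positivity)
  -- Removing the finitely many closed links that miss `z` leaves a neighbourhood whose points in
  -- `I` share a link with `z`.
  have hopen : IsOpen (⋃ i ∈ {i | i ≤ k ∧ (z : X) ∉ K i}, K i)ᶜ := by
    rw [isOpen_compl_iff]
    exact ((finite_Iic k).subset fun i hi => hi.1).isClosed_biUnion
      fun i hi => (h.isContinuum i hi.1).1.isClosed
  have hz : (z : X) ∈ (⋃ i ∈ {i | i ≤ k ∧ (z : X) ∉ K i}, K i)ᶜ := by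
    simp only [mem_compl_iff, mem_iUnion, not_exists]
    exact fun i hi => hi.2
  filter_upwards [(hopen.preimage continuous_subtype_val).mem_nhds hz] with z' hz'
  obtain ⟨i, hi, hzi'⟩ := h.cover z' z'.2
  have hzi : (z : X) ∈ K i := by
    by_contra hcon
    exact hz' (mem_biUnion (show i ∈ {i | i ≤ k ∧ (z : X) ∉ K i} from ⟨hi, hcon⟩) hzi')
  rw [Real.dist_eq, abs_lt]
  constructor <;> linarith [h.infDist_le hI hi hzi hzi' q, h.infDist_le hI hi hzi' hzi q]

/-- Initial parts grow along `I`, so distances to them shrink. A weighted sum of distances from a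
dense sequence is continuous and strictly decreasing: a dense point near the later of two points
detects the difference. -/
theorem IsIrreducibleBetween.exists_continuous_injective (hI : IsIrreducibleBetween I x y)
    (hch : ∀ ε > 0, ∃ K k, IsTautChain I x y ε K k) :
    ∃ f : I → ℝ, Continuous f ∧ Function.Injective f := by
  have : CompactSpace I := isCompact_iff_compactSpace.1 hI.isContinuum.1
  have : Nonempty I := ⟨⟨x, hI.left_mem⟩⟩
  let q : ℕ → I := TopologicalSpace.denseSeq I
  let g : ℕ → I → ℝ := fun l z => (1 / 2) ^ l * infDist (q l : X) (initialPart I x z)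
  have hg0 : ∀ l z, 0 ≤ g l z := fun l z => mul_nonneg (by positivity) infDist_nonneg
  have hgb : ∀ l z, g l z ≤ (1 / 2) ^ l * diam I := fun l z =>
    mul_le_mul_of_nonneg_left ((infDist_le_dist_of_mem (self_mem_initialPart I x z)).trans
      (dist_le_diam_of_mem hI.isContinuum.1.isBounded (q l).2 z.2)) (by positivity)
  have hsum : Summable fun l : ℕ => (1 / 2 : ℝ) ^ l * diam I :=
    summable_geometric_two.mul_right _
  have hs : ∀ z, Summable fun l => g l z := fun z =>
    Summable.of_nonneg_of_le (fun l => hg0 l z) (fun l => hgb l z) hsum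
  have hlt : ∀ z z' : I, initialPart I x z ⊆ initialPart I x z' → (z' : X) ∉ initialPart I x z →
      ∑' l, g l z' < ∑' l, g l z := by
    intro z z' hsub hz'
    have hpos : 0 < infDist (z' : X) (initialPart I x z) :=
      ((isClosed_initialPart I x z).notMem_iff_infDist_pos ⟨z, self_mem_initialPart I x z⟩).1 hz'
    obtain ⟨l, hl⟩ := (TopologicalSpace.denseRange_denseSeq I).exists_dist_lt z' (half_pos hpos)
    refine Summable.tsum_lt_tsum (i := l) (fun m => ?_) ?_ (hs z') (hs z)
    · exact mul_le_mul_of_nonneg_left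
        (infDist_le_infDist_of_subset hsub ⟨z, self_mem_initialPart I x z⟩) (by positivity)
    · refine mul_lt_mul_of_pos_left ?_ (by positivity)
      have h1 : infDist (q l : X) (initialPart I x z') ≤ dist (q l : X) z' :=
        infDist_le_dist_of_mem (self_mem_initialPart I x z')
      have h2 : infDist (z' : X) (initialPart I x z) ≤
          infDist (q l : X) (initialPart I x z) + dist (z' : X) (q l) :=
        infDist_le_infDist_add_dist
      have h3 : dist (z' : X) (q l) < infDist (z' : X) (initialPart I x z) / 2 := hl
      rw [dist_comm] at h1
      linarith
  refine ⟨fun z => ∑' l, g l z, ?_, fun z z' heq => ?_⟩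
  · refine continuous_tsum (fun l => ?_) hsum fun l z => ?_
    · exact continuous_const.mul (hI.continuous_infDist_initialPart hch _)
    · rw [Real.norm_eq_abs, abs_of_nonneg (hg0 l z)]
      exact hgb l z
  · by_contra hne
    rcases hI.initialPart_total hch z.2 z'.2 (fun h => hne (Subtype.ext h)) with h | h
    · exact (hlt z z' h.1 h.2).ne' heq
    · exact (hlt z' z h.1 h.2).ne heq

/-- An irreducible continuum with arbitrarily fine taut chains is an arc. -/
theorem IsIrreducibleBetween.isArc (hI : IsIrreducibleBetween I x y) (hxy : x ≠ y)
    (hch : ∀ ε > 0, ∃ K k, IsTautChain I x y ε K k) : IsArc I := by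
  obtain ⟨f, hf, hinj⟩ := hI.exists_continuous_injective hch
  have : CompactSpace I := isCompact_iff_compactSpace.1 hI.isContinuum.1
  have : ConnectedSpace I := isConnected_iff_connectedSpace.1 hI.isContinuum.2
  have hrange := eq_Icc_of_connected_compact (isConnected_range hf) (isCompact_range hf)
  set a := sInf (range f)
  set b := sSup (range f)
  have hab : a < b := by
    by_contra! hle
    have hss : (range f).Subsingleton := hrange ▸ subsingleton_Icc_of_ge hle
    have := hinj (hss (mem_range_self ⟨x, hI.left_mem⟩) (mem_range_self ⟨y, hI.right_mem⟩))
    exact hxy (congrArg Subtype.val this)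
  exact ⟨(((hf.isClosedEmbedding hinj).isEmbedding.toHomeomorph.trans
    (Homeomorph.setCongr hrange)).trans (iccHomeoI a b hab)).symm⟩

end Arc

end ContinuumConnection

/-! ### Comparison of the two relations -/

namespace ContinuumConnection

open Set Metric

variable {X : Type*} [MetricSpace X]

theorem NoTriod.finite_components {G : Set X} (hG : NoTriod G) {K L : Set X} (hK : IsContinuum K)
    (hL : IsContinuum L) (hKG : K ⊆ G) (hLG : L ⊆ G) :
    (connectedComponentIn (K ∩ L) '' (K ∩ L)).Finite := by
  by_cases h : ∃ a ∈ K ∩ L, ∃ b ∈ K ∩ L, b ∉ connectedComponentIn (K ∩ L) a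
  · obtain ⟨a, ha, b, hb, hab⟩ := h
    refine (Set.toFinite {connectedComponentIn (K ∩ L) a, connectedComponentIn (K ∩ L) b}).subset ?_
    rintro _ ⟨c, hc, rfl⟩
    rw [hG.inter_eq_union_components hK hL hKG hLG ha hb hab] at hc
    exact hc.imp (fun h => (connectedComponentIn_eq h).symm)
      fun h => (connectedComponentIn_eq h).symm
  · push Not at h
    refine Set.Subsingleton.finite ?_
    rintro _ ⟨a, ha, rfl⟩ _ ⟨b, hb, rfl⟩
    exact connectedComponentIn_eq (h a ha b hb)

/-- The components of the sets `I ∩ K i` are small continua covering `I`, and each link contributes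
at most two. -/
theorem NoTriod.exists_isTautChain {G : Set X} (hG : NoTriod G) {I : Set X} {x y : X}
    (hI : IsIrreducibleBetween I x y) (hIG : I ⊆ G) {ε : ℝ} {K : ℕ → Set X} {k : ℕ}
    (hK : IsSmallChain G x ε K k) (hIK : I ⊆ ⋃ i ∈ Icc 0 k, K i) :
    ∃ K k, IsTautChain I x y ε K k := by
  have key : ∀ F ∈ ⋃ i ∈ Icc 0 k, connectedComponentIn (I ∩ K i) '' (I ∩ K i),
      ∃ i ≤ k, ∃ z ∈ I ∩ K i, connectedComponentIn (I ∩ K i) z = F := by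
    intro F hF
    simp only [mem_iUnion, mem_Icc] at hF
    obtain ⟨i, hi, z, hz, rfl⟩ := hF
    exact ⟨i, hi.2, z, hz, rfl⟩
  refine hI.exists_isTautChain
    (𝓕 := ⋃ i ∈ Icc 0 k, connectedComponentIn (I ∩ K i) '' (I ∩ K i)) ?_ ?_ ?_ ?_ ?_
  · exact (finite_Icc 0 k).biUnion fun i hi =>
      hG.finite_components hI.isContinuum (hK.isContinuum i hi.2) hIG (hK.subset i hi.2)
  · intro F hF
    obtain ⟨i, hi, z, hz, rfl⟩ := key F hF
    exact isContinuum_connectedComponentIn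
      (hI.isContinuum.1.inter_right (hK.isContinuum i hi).1.isClosed) hz
  · intro F hF
    obtain ⟨i, hi, z, hz, rfl⟩ := key F hF
    exact (diam_mono ((connectedComponentIn_subset _ _).trans inter_subset_right)
      (hK.isContinuum i hi).1.isBounded).trans_lt (hK.diam_lt i hi)
  · intro F hF
    obtain ⟨i, hi, z, hz, rfl⟩ := key F hF
    exact (connectedComponentIn_subset _ _).trans inter_subset_left
  · intro z hz
    have := hIK hz
    simp only [mem_iUnion] at this
    obtain ⟨i, hi, hzi⟩ := this
    exact ⟨_, mem_biUnion hi ⟨z, ⟨hz, hzi⟩, rfl⟩, mem_connectedComponentIn ⟨hz, hzi⟩⟩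

/-- In a set without triods, two points joined by arbitrarily fine chains of continua lie on an
arc. -/
theorem NoTriod.exists_isArc {G : Set X} (hG : NoTriod G) {x y : X} (hxy : x ≠ y)
    (h : ∀ n : ℕ, ∃ K k, IsSmallChain G x (1 / ((n : ℝ) + 1)) K k ∧ y ∈ K k) :
    ∃ A : Set X, IsArc A ∧ x ∈ A ∧ y ∈ A := by
  choose K k hK hy using h
  have hC : ∀ n, IsContinuum (⋃ i ∈ Icc 0 (k n), K n i) := fun n =>
    isContinuum_biUnion_chain (Nat.zero_le _) (fun i hi => (hK n).isContinuum i hi.2)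
      fun i _ hi => (hK n).meets i hi
  choose D hDC hD using fun n => (hC n).exists_irreducible
    (mem_biUnion (left_mem_Icc.2 (Nat.zero_le _)) (hK n).mem)
    (mem_biUnion (right_mem_Icc.2 (Nat.zero_le _)) (hy n))
  have hDG : ∀ n, D n ⊆ G := fun n =>
    (hDC n).trans (iUnion₂_subset fun i hi => (hK n).subset i hi.2)
  -- Otherwise `D 0` stops recurring from `N` on and `D N` from `M` on, so `D 0`, `D N`, `D (max M
  -- N)` would be three distinct irreducible continua.
  obtain ⟨d, hd⟩ : ∃ d, ∀ N, ∃ n ≥ N, D n = D d := by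
    by_contra! hcon
    obtain ⟨N, hN⟩ := hcon 0
    obtain ⟨M, hM⟩ := hcon N
    have h1 := hN (max M N) (le_max_right _ _)
    have h2 := hM (max M N) (le_max_left _ _)
    rcases hG.eq_or_eq_of_irreducible (hD 0) (hD N) (hD (max M N)) (hDG _) (hDG _) (hDG _)
      (hN N le_rfl).symm with h | h
    exacts [h1 h, h2 h]
  refine ⟨D d, (hD d).isArc hxy fun ε hε => ?_, (hD d).left_mem, (hD d).right_mem⟩
  obtain ⟨N, hN⟩ := exists_nat_one_div_lt hε
  obtain ⟨n, hn, hnd⟩ := hd N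
  obtain ⟨L, l, hL⟩ := hG.exists_isTautChain (hD d) (hDG d) (hK n) (hnd ▸ hDC n)
  have hle : 1 / ((n : ℝ) + 1) ≤ 1 / ((N : ℝ) + 1) := Nat.one_div_le_one_div hn
  exact ⟨L, l, { hL with diam_lt := fun i hi => (hL.diam_lt i hi).trans (hle.trans_lt hN) }⟩

theorem chainRel_subset_arcRel
    (h : ∀ x : X, NoTriod (relClass (chainRelAt X 1) x)) : chainRel X ⊆ arcRel X := by
  rintro ⟨x, y⟩ hxy
  by_cases hne : x = y
  · exact Or.inl hne
  refine Or.inr ((h x).exists_isArc hne fun n => ?_)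
  have hle : 1 / ((n : ℝ) + 1) ≤ 1 := by
    rw [div_le_one (by positivity)]
    exact le_add_of_nonneg_left n.cast_nonneg
  obtain ⟨k, K, hK, hx, hy, hm⟩ := hxy (1 / ((n : ℝ) + 1)) (by positivity)
  refine ⟨K, k, ⟨fun i hi => (hK i hi).1, fun i hi => (hK i hi).2, fun i hi z hz => ?_, hx, hm⟩, hy⟩
  -- The links up to `i` witness that `K i` lies in the class of `x`.
  exact ⟨i, K, fun j hj => ⟨(hK j (hj.trans hi)).1, (hK j (hj.trans hi)).2.trans_le hle⟩, hx, hz,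
    fun j hj => hm j (hj.trans_le hi)⟩

theorem mem_chainRel_of_path {x y : X} (γ : Path x y) : (x, y) ∈ chainRel X := by
  intro ε hε
  have huc : UniformContinuousOn γ.extend (Icc 0 1) :=
    isCompact_Icc.uniformContinuousOn_of_continuous γ.continuous_extend.continuousOn
  obtain ⟨δ, hδ, hγ⟩ := Metric.uniformContinuousOn_iff.1 huc (ε / 2) (half_pos hε)
  obtain ⟨n, hn⟩ := exists_nat_one_div_lt hδ
  have hn0 : (0 : ℝ) < (n : ℝ) + 1 := by positivity
  let a : ℕ → ℝ := fun i => i / ((n : ℝ) + 1)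
  have hmono : Monotone a := fun i j hij => by
    simp only [a]
    gcongr
  have ha0 : a 0 = 0 := by simp [a]
  have ha1 : a (n + 1) = 1 := by
    simp only [a]
    push_cast
    exact div_self hn0.ne'
  have hstep : ∀ i, a (i + 1) - a i = 1 / ((n : ℝ) + 1) := fun i => by
    simp only [a]
    push_cast
    ring
  -- The links `0, …, n` are the images of the `n + 1` equal subintervals of `[0, 1]`.
  refine ⟨n, fun i => γ.extend '' Icc (a i) (a (i + 1)), fun i hi => ⟨⟨?_, ?_⟩, ?_⟩, ?_, ?_,
    fun i _ => ?_⟩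
  · exact isCompact_Icc.image γ.continuous_extend
  · exact (isConnected_Icc (hmono i.le_succ)).image _ γ.continuous_extend.continuousOn
  · have hsub : Icc (a i) (a (i + 1)) ⊆ Icc 0 1 := by
      rw [← ha0, ← ha1]
      exact Icc_subset_Icc (hmono (Nat.zero_le _)) (hmono (Nat.succ_le_succ hi))
    refine (diam_le_of_forall_dist_le (half_pos hε).le ?_).trans_lt (half_lt_self hε)
    rintro _ ⟨s, hs, rfl⟩ _ ⟨t, ht, rfl⟩
    refine (hγ s (hsub hs) t (hsub ht) ?_).le
    rw [Real.dist_eq, abs_lt]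
    constructor <;> linarith [hs.1, hs.2, ht.1, ht.2, hstep i]
  · exact ⟨0, ⟨ha0.le, ha0 ▸ hmono (Nat.zero_le 1)⟩, γ.extend_zero⟩
  · exact ⟨1, ⟨ha1 ▸ hmono n.le_succ, ha1.ge⟩, γ.extend_one⟩
  · exact ⟨_, ⟨_, right_mem_Icc.2 (hmono i.le_succ), rfl⟩,
      ⟨_, left_mem_Icc.2 (hmono (i + 1).le_succ), rfl⟩⟩

theorem arcRel_subset_chainRel : arcRel X ⊆ chainRel X := by
  rintro ⟨x, y⟩ (h | ⟨A, ⟨e⟩, hx, hy⟩)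
  · obtain rfl : x = y := h
    exact mem_chainRel_of_path (Path.refl x)
  · have hcont : Continuous fun t => (e t : X) := continuous_subtype_val.comp e.continuous
    have : PathConnectedSpace unitInterval :=
      isPathConnected_iff_pathConnectedSpace.1 ((convex_Icc (0 : ℝ) 1).isPathConnected ⟨0, by simp⟩)
    have := mem_chainRel_of_path
      ((PathConnectedSpace.somePath (e.symm ⟨x, hx⟩) (e.symm ⟨y, hy⟩)).map hcont)
    simpa using this

theorem chainRel_eq_arcRel (h : ∀ x : X, NoTriod (relClass (chainRelAt X 1) x)) :
    chainRel X = arcRel X :=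
  (chainRel_subset_arcRel h).antisymm arcRel_subset_chainRel

end ContinuumConnection

theorem mainTheorem11 :
    (∀ (X : Type*) [MetricSpace X],
      (∀ n : ℕ, 1 ≤ n → ∀ x : X,
        ¬ ∃ T : Set X, IsTriod T ∧ T ⊆ relClass (chainRelAt X (1 / (n : ℝ))) x) →
      chainRel X = arcRel X) ∧
    (∀ (X : Type*) [MetricSpace X] [PolishSpace X],
      (¬ ∃ T : Set X, IsTriod T) →
      chainRel X = arcRel X) := by
  refine ⟨fun X _ h => chainRel_eq_arcRel fun x => ?_,
    fun X _ _ h => chainRel_eq_arcRel fun x => ?_⟩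
  · simpa [NoTriod] using h 1 le_rfl x
  · exact fun ⟨T, hT, _⟩ => h ⟨T, hT⟩
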